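/- Let $N$ users (transmitter–receiver pairs) share $u$ orthogonal frequency sub-bands, and let $1\le v_k\le u$ for $1\le k\le N$. In each slot user $k$ selects a set $S_k$ of exactly $v_k$ sub-bands, uniformly at random among all such sets, and sends independent real Gaussian symbols of mean $0$ and variance $P/v_k$ on the selected sub-bands and $0$ on the others; this gives the transmitted vector $\vec X_k\in\mathbb R^u$. All selections and symbols of all users are independent. With real channel gains $h_{k,i}$ (from transmitter $k$ to receiver $i$), receiver $i$ observes $$\vec Y_i=h_{i,i}\vec X_i+\sum_{k\ne i}h_{k,i}\vec X_k+\vec\nu_i,$$ where $\vec\nu_i$ is a zero-mean Gaussian vector with covariance matrix $\sigma^2 I_u$, independent of everything else. Put $\gamma=P/\sigma^2$ ($P,\sigma>0$) and let $$\mathscr R_i=\mathrm I(\vec X_i;\vec Y_i\mid S_i)=\sum_{s}\Pr(S_i=s)\,\mathrm I(\vec X_i;\vec Y_i\mid S_i=s)$$ be the achievable rate of user $i$ in bits ($\log$ denotes the logarithm to base $2$). Assume that $h_{k,i}\neq0$ for all $k\ne i$. **Theorem 1.** There is a function $\widetilde{\mathscr R}_{i,\mathrm{ub}}$ of $\gamma$,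 depending only on $N,u,i$, the $v_k$ and the channel gains, which has a finite limit as $\gamma\to\infty$, such that for all $P,\sigma>0$ the rate $\mathscr R_i$ is finite and $$\mathscr R_i\le\mathscr R_{i,\mathrm{ub}}(\gamma):=\frac12 v_i\prod_{k\neq i}\Bigl(1-\frac{v_k}{u}\Bigr)\log\Bigl(1+\frac{|h_{i,i}|^2\gamma}{v_i}\Bigr)+\widetilde{\mathscr R}_{i,\mathrm{ub}}(\gamma).$$ If moreover $h_{i,i}\ne0$, then $\mathscr R_{i,\mathrm{ub}}(\gamma)/\log\gamma\to\frac12 v_i\prod_{k\neq i}(1-\frac{v_k}{u})$ as $\gamma\to\infty$; in particular, if also $v_k<u$ for all $k\neq i$, then $\mathscr R_{i,\mathrm{ub}}\sim\frac12 v_i\prod_{k\neq i}(1-\frac{v_k}{u})\log\gamma$, meaning that the quotient of the two sides tends to $1$. -/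

import Mathlib

open MeasureTheory ProbabilityTheory Filter Topology
open scoped NNReal ENNReal

/-- Finite sets of sub-bands carry the discrete σ-algebra. -/
instance instMeasurableSpaceFinsetFin (u : ℕ) : MeasurableSpace (Finset (Fin u)) := ⊤

noncomputable section

namespace FrequencyHopping

/-- Mutual information `I(X;Y)` in bits: the Kullback-Leibler divergence of the joint law from the
product of the marginal laws, divided by `log 2`. -/
def mutualInfo {Ω α β : Type*} [MeasurableSpace Ω] [MeasurableSpace α] [MeasurableSpace β]
    (μ : Measure Ω) (X : Ω → α) (Y : Ω → β) : ℝ≥0∞ :=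
  InformationTheory.klDiv (μ.map (fun ω => (X ω, Y ω))) ((μ.map X).prod (μ.map Y)) /
    ENNReal.ofReal (Real.log 2)

/-- Conditional mutual information given a discrete random variable with finitely many values:
`I(X;Y|S) = ∑ s, Pr(S = s) * I(X;Y|S = s)`. -/
def condMutualInfo {Ω α β ι : Type*} [MeasurableSpace Ω] [MeasurableSpace α] [MeasurableSpace β]
    [Fintype ι] (μ : Measure Ω) (X : Ω → α) (Y : Ω → β) (S : Ω → ι) : ℝ≥0∞ :=
  ∑ s : ι, μ (S ⁻¹' {s}) * mutualInfo (ProbabilityTheory.cond μ (S ⁻¹' {s})) X Y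

/-- Sample space of one transmission slot, as seen by one receiver: the set of sub-bands selected
by each user, the Gaussian symbols of each user, one per sub-band (only those on the selected
sub-bands are sent), and the ambient noise on each sub-band at that receiver. -/
abbrev Slot (N u : ℕ) : Type :=
  (Fin N → Finset (Fin u)) × (Fin N → Fin u → ℝ) × (Fin u → ℝ)

/-- The law of one slot. All coordinates are independent; the selection of user `k` is uniform
among the sets of `v k` sub-bands, its symbols are `N(0, P / v k)`, the noise is `N(0, σ ^ 2)`. -/
def slotMeasure {N u : ℕ} (v : Fin N → ℕ) (P σ : ℝ≥0) : Measure (Slot N u) :=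
  (Measure.pi fun k => uniformOn {s : Finset (Fin u) | s.card = v k}).prod
    ((Measure.pi fun k => Measure.pi fun _ : Fin u => gaussianReal 0 (P / (v k : ℝ≥0))).prod
      (Measure.pi fun _ : Fin u => gaussianReal 0 (σ ^ 2)))

/-- The hopping pattern `S_k` of user `k`. -/
def hopping {N u : ℕ} (k : Fin N) (ω : Slot N u) : Finset (Fin u) := ω.1 k

/-- The transmitted vector `X_k` of user `k`: its symbols on the selected sub-bands, zero on the
other ones. -/
def transmitted {N u : ℕ} (k : Fin N) (ω : Slot N u) : Fin u → ℝ :=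
  fun j => if j ∈ hopping k ω then ω.2.1 k j else 0

/-- Noise plus interference `Z_i` at receiver `i`, where `h k i` is the gain from transmitter `k`
to receiver `i`. -/
def noisePlusInterference {N u : ℕ} (h : Fin N → Fin N → ℝ) (i : Fin N) (ω : Slot N u) :
    Fin u → ℝ :=
  fun j => (∑ k ∈ Finset.univ.erase i, h k i * transmitted k ω j) + ω.2.2 j

/-- The vector `Y_i = h i i • X_i + Z_i` received by user `i`. -/
def received {N u : ℕ} (h : Fin N → Fin N → ℝ) (i : Fin N) (ω : Slot N u) : Fin u → ℝ :=
  fun j => h i i * transmitted i ω j + noisePlusInterference h i ω j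

/-- The achievable rate `R_i = I(X_i;Y_i|S_i)` of user `i`, in bits. -/
def achievableRate {N : ℕ} (u : ℕ) (v : Fin N → ℕ) (h : Fin N → Fin N → ℝ) (P σ : ℝ≥0)
    (i : Fin N) : ℝ≥0∞ :=
  condMutualInfo (slotMeasure (u := u) v P σ) (transmitted i) (received h i) (hopping i)

/-- The multiplexing gain `(1/2) v_i ∏_{k ≠ i} (1 - v_k / u)`. -/
def multiplexingGain {N : ℕ} (u : ℕ) (v : Fin N → ℕ) (i : Fin N) : ℝ :=
  1 / 2 * (v i : ℝ) * ∏ k ∈ Finset.univ.erase i, (1 - (v k : ℝ) / (u : ℝ))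

/-- The upper bound at signal-to-noise ratio `γ`, with remainder term `Rt`. -/
def rateUpperBound {N : ℕ} (u : ℕ) (v : Fin N → ℕ) (h : Fin N → Fin N → ℝ) (i : Fin N)
    (Rt : ℝ → ℝ) (γ : ℝ) : ℝ :=
  multiplexingGain u v i * Real.logb 2 (1 + |h i i| ^ 2 * γ / (v i : ℝ)) + Rt γ

end FrequencyHopping

end

/-! Tell the receiver all hopping patterns. Given `S_i = s`, the law of the input does not depend on
the other users' patterns, so the joint law and the product of the marginals are mixtures over
patterns with the same weights. Joint convexity of the divergence (`klDiv_sum_smul_le`) then bounds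
the mutual information by the average of its values for fixed patterns
(`mutualInfo_le_sum_patternRate`).

For a fixed pattern everything is Gaussian with independent coordinates, so the sub-bands are
parallel scalar channels, each contributing `1/2 log (1 + SNR)` nats (`klDiv_pattern_le`). A
sub-band not used by user `i` contributes nothing. One used without interference contributes `1/2
log (1 + |h i i|^2 γ / v i)`. On one shared with an interferer `k`, the disturbance has power at
least `h k i ^ 2 * P / v k`, so `P` cancels and the contribution stays below a constant
(`bandRate_le`).

Independence gives each sub-band the probability `(v i / u) ∏ (1 - v k / u)` of being used by `i`
without interference. Summing over the `u` sub-bands produces the multiplexing gain, and the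
interfered sub-bands cost only a constant remainder. -/

namespace InformationTheory

/-! ### Convexity and tensorization of the divergence. -/

section KullbackLeibler

variable {α β : Type*} [MeasurableSpace α] [MeasurableSpace β]

/-- The Kullback-Leibler divergence is jointly subadditive. -/
lemma klDiv_add_le (μ₁ μ₂ ν₁ ν₂ : Measure α) [IsFiniteMeasure μ₁] [IsFiniteMeasure μ₂]
    [IsFiniteMeasure ν₁] [IsFiniteMeasure ν₂] :
    klDiv (μ₁ + μ₂) (ν₁ + ν₂) ≤ klDiv μ₁ ν₁ + klDiv μ₂ ν₂ := by
  by_cases h₁ : μ₁ ≪ ν₁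
  swap
  · simp [klDiv_of_not_ac h₁]
  by_cases h₂ : μ₂ ≪ ν₂
  swap
  · simp [klDiv_of_not_ac h₂]
  have hR₁ : ν₁ ≪ ν₁ + ν₂ := Measure.AbsolutelyContinuous.rfl.add_right ν₂
  have hR₂ : ν₂ ≪ ν₁ + ν₂ := by
    rw [add_comm]; exact Measure.AbsolutelyContinuous.rfl.add_right ν₁
  have hac : μ₁ + μ₂ ≪ ν₁ + ν₂ := (h₁.trans hR₁).add_left (h₂.trans hR₂)
  -- Against the common measure `ν₁ + ν₂`, the densities of `ν₁` and `ν₂` sum to one almost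
  -- everywhere. They serve as convex weights, and the claim becomes pointwise convexity of `klFun`.
  rw [klDiv_eq_lintegral_klFun_of_ac h₁, klDiv_eq_lintegral_klFun_of_ac h₂,
    klDiv_eq_lintegral_klFun_of_ac hac, ← lintegral_rnDeriv_mul hR₁ (by fun_prop),
    ← lintegral_rnDeriv_mul hR₂ (by fun_prop), ← lintegral_add_left (by fun_prop)]
  refine lintegral_mono_ae ?_
  filter_upwards [Measure.rnDeriv_add μ₁ μ₂ (ν₁ + ν₂), Measure.rnDeriv_add ν₁ ν₂ (ν₁ + ν₂),
    Measure.rnDeriv_self (ν₁ + ν₂), Measure.rnDeriv_mul_rnDeriv (κ := ν₁ + ν₂) h₁,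
    Measure.rnDeriv_mul_rnDeriv (κ := ν₁ + ν₂) h₂,
    Measure.rnDeriv_lt_top μ₁ (ν₁ + ν₂), Measure.rnDeriv_lt_top μ₂ (ν₁ + ν₂),
    Measure.rnDeriv_lt_top ν₁ (ν₁ + ν₂), Measure.rnDeriv_lt_top ν₂ (ν₁ + ν₂)]
    with x hμ hν hself hm₁ hm₂ hμt₁ hμt₂ hνt₁ hνt₂
  rw [hν, Pi.add_apply] at hself
  rw [hμ, Pi.add_apply, ENNReal.toReal_add hμt₁.ne hμt₂.ne, ← hm₁, ← hm₂, Pi.mul_apply,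
    Pi.mul_apply, ENNReal.toReal_mul, ENNReal.toReal_mul]
  set p₁ := (μ₁.rnDeriv ν₁ x).toReal
  set p₂ := (μ₂.rnDeriv ν₂ x).toReal
  have hp₁ : 0 ≤ p₁ := ENNReal.toReal_nonneg
  have hp₂ : 0 ≤ p₂ := ENNReal.toReal_nonneg
  have hsum : (ν₁.rnDeriv (ν₁ + ν₂) x).toReal + (ν₂.rnDeriv (ν₁ + ν₂) x).toReal = 1 := by
    rw [← ENNReal.toReal_add hνt₁.ne hνt₂.ne, hself]
    simp
  have hconv := convexOn_klFun.2 (Set.mem_Ici.2 hp₁) (Set.mem_Ici.2 hp₂)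
    ENNReal.toReal_nonneg ENNReal.toReal_nonneg hsum
  simp only [smul_eq_mul] at hconv
  rw [mul_comm p₁, mul_comm p₂]
  refine (ENNReal.ofReal_le_ofReal hconv).trans ?_
  rw [ENNReal.ofReal_add (mul_nonneg ENNReal.toReal_nonneg (klFun_nonneg hp₁))
    (mul_nonneg ENNReal.toReal_nonneg (klFun_nonneg hp₂)),
    ENNReal.ofReal_mul ENNReal.toReal_nonneg, ENNReal.ofReal_mul ENNReal.toReal_nonneg,
    ENNReal.ofReal_toReal hνt₁.ne, ENNReal.ofReal_toReal hνt₂.ne]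

/-- The Kullback-Leibler divergence is jointly convex. -/
lemma klDiv_sum_smul_le {ι : Type*} (s : Finset ι) (w : ι → ℝ≥0) (μ ν : ι → Measure α)
    [∀ a, IsFiniteMeasure (μ a)] [∀ a, IsFiniteMeasure (ν a)] :
    klDiv (∑ a ∈ s, w a • μ a) (∑ a ∈ s, w a • ν a) ≤ ∑ a ∈ s, w a * klDiv (μ a) (ν a) := by
  classical
  induction s using Finset.induction_on with
  | empty => simp
  | insert a s ha ih =>
    simp only [Finset.sum_insert ha]
    refine (klDiv_add_le _ _ _ _).trans (add_le_add ?_ ih)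
    rw [klDiv_smul_same]

/-- A common independent component does not change the divergence. -/
lemma klDiv_prod_left_le (ρ : Measure β) (μ ν : Measure α) [IsProbabilityMeasure ρ]
    [IsFiniteMeasure μ] [IsFiniteMeasure ν] :
    klDiv (μ.prod ρ) (ν.prod ρ) ≤ klDiv μ ν := by
  rw [← Measure.compProd_const, ← Measure.compProd_const, klDiv_compProd_left]

lemma klDiv_prod_right_le (ρ : Measure β) (μ ν : Measure α) [IsProbabilityMeasure ρ]
    [IsFiniteMeasure μ] [IsFiniteMeasure ν] :
    klDiv (ρ.prod μ) (ρ.prod ν) ≤ klDiv μ ν := by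
  rw [← Measure.prod_swap, ← Measure.prod_swap (μ := ν)]
  exact (klDiv_map_le _ _ measurable_swap).trans (klDiv_prod_left_le ρ μ ν)

/-- Chain rule through the intermediate measure `μ₁.prod ν₂`; a product is a composition with a
constant kernel. -/
lemma klDiv_prod_le (μ₁ ν₁ : Measure α) (μ₂ ν₂ : Measure β) [IsProbabilityMeasure μ₁]
    [IsProbabilityMeasure ν₁] [IsProbabilityMeasure μ₂] [IsProbabilityMeasure ν₂] :
    klDiv (μ₁.prod μ₂) (ν₁.prod ν₂) ≤ klDiv μ₁ ν₁ + klDiv μ₂ ν₂ := by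
  rw [← Measure.compProd_const, ← Measure.compProd_const (ν := ν₂), klDiv_compProd_eq_add,
    Measure.compProd_const, Measure.compProd_const]
  gcongr
  exact klDiv_prod_right_le μ₁ μ₂ ν₂

/-- Subadditivity of the divergence over the factors of a finite product. -/
lemma klDiv_pi_le {n : ℕ} (μ ν : Fin n → Measure α) [∀ j, IsProbabilityMeasure (μ j)]
    [∀ j, IsProbabilityMeasure (ν j)] :
    klDiv (Measure.pi μ) (Measure.pi ν) ≤ ∑ j, klDiv (μ j) (ν j) := by
  induction n with
  | zero =>
    have : μ = ν := Subsingleton.elim _ _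
    subst this
    simp
  | succ n ih =>
    have hμ := (measurePreserving_piFinSuccAbove μ 0).symm.map_eq
    have hν := (measurePreserving_piFinSuccAbove ν 0).symm.map_eq
    rw [← hμ, ← hν, Fin.sum_univ_succ]
    refine (klDiv_map_le _ _ (MeasurableEquiv.measurable _)).trans ((klDiv_prod_le _ _ _ _).trans ?_)
    gcongr
    exact ih _ _

/-- A bound on the divergence from an explicit log-density. -/
lemma klDiv_withDensity_exp_eq (μ ν : Measure α) [IsProbabilityMeasure μ] [IsProbabilityMeasure ν]
    {g : α → ℝ} (hg : Measurable g) (hμ : μ = ν.withDensity fun x => ENNReal.ofReal (Real.exp (g x)))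
    (hint : Integrable g μ) : klDiv μ ν = ENNReal.ofReal (∫ x, g x ∂μ) := by
  have hac : μ ≪ ν := hμ ▸ withDensity_absolutelyContinuous _ _
  have hllr : llr μ ν =ᵐ[μ] g := by
    refine hac ?_
    have h := Measure.rnDeriv_withDensity ν (f := fun x => ENNReal.ofReal (Real.exp (g x)))
      (by fun_prop)
    rw [← hμ] at h
    filter_upwards [h] with x hx
    rw [llr, hx, ENNReal.toReal_ofReal (Real.exp_pos _).le, Real.log_exp]
  rw [klDiv_of_ac_of_integrable hac ((integrable_congr hllr).2 hint), integral_congr_ae hllr]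
  simp

end KullbackLeibler
end InformationTheory

namespace FrequencyHopping

/-! ### The scalar Gaussian channel. -/

section GaussianChannel

lemma integral_sq_gaussianReal (p : ℝ≥0) : ∫ x : ℝ, x ^ 2 ∂gaussianReal 0 p = p := by
  have h := variance_eq_sub (memLp_id_gaussianReal (μ := 0) (v := p) 2)
  rw [variance_id_gaussianReal] at h
  simpa using h.symm

lemma integrable_sq_gaussianReal (p : ℝ≥0) :
    Integrable (fun x : ℝ => x ^ 2) (gaussianReal 0 p) :=
  (memLp_id_gaussianReal (μ := 0) (v := p) 2).integrable_sq

lemma gaussianReal_map_mul (p : ℝ≥0) (c : ℝ) :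
    (gaussianReal 0 p).map (fun x => c * x) = gaussianReal 0 (‖c‖₊ ^ 2 * p) := by
  rw [gaussianReal_map_const_mul, mul_zero]
  congr 2
  ext
  simp

lemma gaussianReal_prod_map_add (p q : ℝ≥0) :
    ((gaussianReal 0 p).prod (gaussianReal 0 q)).map (fun x : ℝ × ℝ => x.1 + x.2)
      = gaussianReal 0 (p + q) := by
  have h := @gaussianReal_conv_gaussianReal 0 0 p q
  rwa [add_zero] at h

/-- The law of the output of a scalar Gaussian channel of gain `c`. -/
lemma gaussianReal_prod_map_mul_add (p q : ℝ≥0) (c : ℝ) :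
    ((gaussianReal 0 p).prod (gaussianReal 0 q)).map (fun x : ℝ × ℝ => c * x.1 + x.2)
      = gaussianReal 0 (‖c‖₊ ^ 2 * p + q) := by
  rw [← gaussianReal_prod_map_add, ← gaussianReal_map_mul]
  conv_rhs => rw [← Measure.map_id (μ := gaussianReal 0 q)]
  rw [Measure.map_prod_map _ _ (by fun_prop) measurable_id,
    Measure.map_map (by fun_prop) (by fun_prop)]
  rfl

/-- The input-output law of a scalar Gaussian channel has the shifted Gaussian density. -/
lemma gaussianReal_prod_map_shear (p τ : ℝ≥0) (hτ : τ ≠ 0) (c : ℝ) :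
    ((gaussianReal 0 p).prod (gaussianReal 0 τ)).map (fun x : ℝ × ℝ => (x.1, c * x.1 + x.2))
      = ((gaussianReal 0 p).prod volume).withDensity
        (fun w => gaussianPDF 0 τ (w.2 - c * w.1)) := by
  -- On each fibre the shear is a translation, which preserves Lebesgue measure; hence the density
  -- is merely carried along by the shear.
  have hT : MeasurePreserving (fun x : ℝ × ℝ => (x.1, c * x.1 + x.2))
      ((gaussianReal 0 p).prod volume) ((gaussianReal 0 p).prod volume) :=
    (MeasurePreserving.id _).skew_product (g := fun x z => c * x + z) (by fun_prop)
      (Eventually.of_forall fun x => map_add_left_eq_self volume (c * x))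
  rw [gaussianReal_of_var_ne_zero 0 hτ, prod_withDensity_right (measurable_gaussianPDF 0 τ)]
  ext s hs
  rw [Measure.map_apply hT.measurable hs, withDensity_apply _ (hT.measurable hs),
    withDensity_apply _ hs]
  conv_rhs => rw [← hT.map_eq]
  rw [setLIntegral_map hs (by fun_prop) hT.measurable]
  simp

/-- The logarithm of the density of the input-output law of a scalar Gaussian channel with respect
to the product of its marginals. -/
noncomputable def channelLogDensity (c : ℝ) (s τ : ℝ≥0) (w : ℝ × ℝ) : ℝ :=
  1 / 2 * Real.log (s / τ) - (w.2 - c * w.1) ^ 2 / (2 * τ) + w.2 ^ 2 / (2 * s)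

lemma measurable_channelLogDensity (c : ℝ) (s τ : ℝ≥0) :
    Measurable (channelLogDensity c s τ) := by
  unfold channelLogDensity
  fun_prop

/-- The ratio of the normalising constants is `√(s / τ)`, the source of the logarithmic term; the
two quadratic terms are the exponents. -/
lemma gaussianPDF_shift_eq (c : ℝ) {s τ : ℝ≥0} (hs : s ≠ 0) (hτ : τ ≠ 0) (w : ℝ × ℝ) :
    gaussianPDF 0 τ (w.2 - c * w.1) =
      gaussianPDF 0 s w.2 * ENNReal.ofReal (Real.exp (channelLogDensity c s τ w)) := by
  rw [gaussianPDF, gaussianPDF, ← ENNReal.ofReal_mul (gaussianPDFReal_nonneg _ _ _)]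
  congr 1
  have hs' : (0 : ℝ) < s := by positivity
  have hτ' : (0 : ℝ) < τ := by positivity
  have hlog : Real.exp (1 / 2 * Real.log (s / τ)) = √s / √τ := by
    rw [← Real.sqrt_div hs'.le, Real.sqrt_eq_rpow, Real.rpow_def_of_pos (by positivity), mul_comm]
  have hexp : channelLogDensity c s τ w = 1 / 2 * Real.log (s / τ) +
      (-(w.2 - c * w.1) ^ 2 / (2 * τ) - -w.2 ^ 2 / (2 * s)) := by
    unfold channelLogDensity; ring
  rw [hexp, Real.exp_add, hlog, Real.exp_sub, gaussianPDFReal, gaussianPDFReal,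
    Real.sqrt_mul (by positivity) (s : ℝ), Real.sqrt_mul (by positivity) (τ : ℝ)]
  simp only [sub_zero]
  have := (Real.exp_pos (-w.2 ^ 2 / (2 * s))).ne'
  have := (Real.sqrt_pos.2 hs').ne'
  have := (Real.sqrt_pos.2 hτ').ne'
  field_simp

/-- The capacity formula for the scalar Gaussian channel with Gaussian input, as a bound. -/
lemma klDiv_gaussian_channel_le (p τ : ℝ≥0) (hτ : τ ≠ 0) (c : ℝ) :
    InformationTheory.klDiv
      (((gaussianReal 0 p).prod (gaussianReal 0 τ)).map
        (fun x : ℝ × ℝ => (x.1, c * x.1 + x.2)))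
      ((gaussianReal 0 p).prod (gaussianReal 0 (‖c‖₊ ^ 2 * p + τ)))
      ≤ ENNReal.ofReal (1 / 2 * Real.log (1 + c ^ 2 * p / τ)) := by
  set s : ℝ≥0 := ‖c‖₊ ^ 2 * p + τ with hs_def
  have hs : s ≠ 0 := by positivity
  have hs' : (0 : ℝ) < s := by positivity
  have hτ' : (0 : ℝ) < τ := by positivity
  have hscoe : (s : ℝ) = c ^ 2 * p + τ := by simp [hs_def]
  have hT : Measurable (fun x : ℝ × ℝ => (x.1, c * x.1 + x.2)) := by fun_prop
  set ρ := ((gaussianReal 0 p).prod (gaussianReal 0 τ)).map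
    (fun x : ℝ × ℝ => (x.1, c * x.1 + x.2)) with hρ
  have : IsProbabilityMeasure ρ := Measure.isProbabilityMeasure_map hT.aemeasurable
  have hg := measurable_channelLogDensity c s τ
  -- Only the output needs a density. The input may be degenerate (`p = 0`), which is the case of an
  -- unselected sub-band.
  have hdens : ρ = ((gaussianReal 0 p).prod (gaussianReal 0 s)).withDensity
      fun w => ENNReal.ofReal (Real.exp (channelLogDensity c s τ w)) := by
    rw [hρ, gaussianReal_prod_map_shear p τ hτ c, gaussianReal_of_var_ne_zero 0 hs,
      prod_withDensity_right (measurable_gaussianPDF 0 s),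
      ← withDensity_mul _ (by fun_prop) (by fun_prop)]
    congr 1
    ext w
    exact gaussianPDF_shift_eq c hs hτ w
  have hcomp : ∀ x : ℝ × ℝ, channelLogDensity c s τ (x.1, c * x.1 + x.2) =
      1 / 2 * Real.log (s / τ) - x.2 ^ 2 / (2 * τ) + (c * x.1 + x.2) ^ 2 / (2 * s) := by
    intro x
    simp [channelLogDensity]
  have hi₁ : Integrable (fun x : ℝ × ℝ => x.2 ^ 2)
      ((gaussianReal 0 p).prod (gaussianReal 0 τ)) :=
    (integrable_sq_gaussianReal τ).comp_snd _
  have hi₂ : Integrable (fun x : ℝ × ℝ => (c * x.1 + x.2) ^ 2)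
      ((gaussianReal 0 p).prod (gaussianReal 0 τ)) := by
    have h := integrable_sq_gaussianReal s
    rw [hs_def, ← gaussianReal_prod_map_mul_add] at h
    exact (integrable_map_measure (by fun_prop) (by fun_prop)).1 h
  have he₁ : ∫ x : ℝ × ℝ, x.2 ^ 2 ∂((gaussianReal 0 p).prod (gaussianReal 0 τ)) = τ := by
    rw [integral_fun_snd (fun z : ℝ => z ^ 2), integral_sq_gaussianReal]
    simp
  have he₂ : ∫ x : ℝ × ℝ, (c * x.1 + x.2) ^ 2
      ∂((gaussianReal 0 p).prod (gaussianReal 0 τ)) = s := by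
    rw [← integral_sq_gaussianReal s, hs_def, ← gaussianReal_prod_map_mul_add,
      integral_map (by fun_prop) (by fun_prop)]
  have hint : Integrable (channelLogDensity c s τ) ρ := by
    rw [hρ, integrable_map_measure hg.aestronglyMeasurable hT.aemeasurable]
    simp only [Function.comp_def, hcomp]
    exact ((integrable_const _).sub (hi₁.div_const _)).add (hi₂.div_const _)
  rw [InformationTheory.klDiv_withDensity_exp_eq ρ _ hg hdens hint, hρ,
    integral_map hT.aemeasurable hg.aestronglyMeasurable]
  simp only [hcomp]
  have hi₃ : Integrable (fun x : ℝ × ℝ => 1 / 2 * Real.log (s / τ) - x.2 ^ 2 / (2 * τ))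
      ((gaussianReal 0 p).prod (gaussianReal 0 τ)) :=
    (integrable_const _).sub (hi₁.div_const _)
  -- The noise has second moment `τ` and the output `s`, so the quadratic terms average to `-1/2`
  -- and `1/2` and cancel.
  rw [integral_add hi₃ (hi₂.div_const _),
    integral_sub (integrable_const _) (hi₁.div_const _), integral_div, integral_div, he₁, he₂,
    integral_const]
  refine ENNReal.ofReal_le_ofReal (le_of_eq ?_)
  have : (s : ℝ) / τ = 1 + c ^ 2 * p / τ := by
    rw [hscoe]; field_simp; ring
  rw [this]
  simp only [smul_eq_mul, one_mul, probReal_univ]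
  field_simp
  ring

end GaussianChannel
-- Parallel Gaussian channels.
section GaussianVectors

variable {ι : Type*} [Fintype ι]

/-- Pairing the coordinates of two independent product-distributed vectors. -/
lemma pi_prod_pi_eq_map {α β : Type*} [MeasurableSpace α] [MeasurableSpace β]
    (μ : ι → Measure α) (ν : ι → Measure β) [∀ j, SigmaFinite (μ j)] [∀ j, SigmaFinite (ν j)] :
    (Measure.pi μ).prod (Measure.pi ν) = (Measure.pi fun j => (μ j).prod (ν j)).map
      (fun w => ((fun j => (w j).1), (fun j => (w j).2))) :=
  (measurePreserving_arrowProdEquivProdArrow α β ι μ ν).map_eq.symm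

/-- Coordinatewise images of two independent product-distributed vectors. -/
lemma pi_prod_pi_map {α β γ : Type*} [MeasurableSpace α] [MeasurableSpace β] [MeasurableSpace γ]
    (μ : ι → Measure α) (ν : ι → Measure β) [∀ j, IsProbabilityMeasure (μ j)]
    [∀ j, IsProbabilityMeasure (ν j)] {f : ι → α × β → γ} (hf : ∀ j, Measurable (f j)) :
    ((Measure.pi μ).prod (Measure.pi ν)).map (fun x j => f j (x.1 j, x.2 j))
      = Measure.pi fun j => ((μ j).prod (ν j)).map (f j) := by
  have (j : ι) : IsProbabilityMeasure (((μ j).prod (ν j)).map (f j)) :=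
    Measure.isProbabilityMeasure_map (hf j).aemeasurable
  rw [pi_prod_pi_eq_map, Measure.map_map (by fun_prop) (by fun_prop),
    ← Measure.pi_map_pi fun j => (hf j).aemeasurable]
  rfl

lemma gaussianVector_map_mul_add (p q : ι → ℝ≥0) (c : ℝ) :
    ((Measure.pi fun j => gaussianReal 0 (p j)).prod (Measure.pi fun j => gaussianReal 0 (q j))).map
      (fun x j => c * x.1 j + x.2 j)
      = Measure.pi fun j => gaussianReal 0 (‖c‖₊ ^ 2 * p j + q j) := by
  rw [pi_prod_pi_map (fun j => gaussianReal 0 (p j)) (fun j => gaussianReal 0 (q j))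
    (f := fun _ x => c * x.1 + x.2) (by fun_prop)]
  simp_rw [gaussianReal_prod_map_mul_add]

/-- Sum bound for the divergence associated with parallel Gaussian channels. -/
lemma klDiv_parallel_gaussian_channels_le {n : ℕ} (p τ : Fin n → ℝ≥0) (hτ : ∀ j, τ j ≠ 0) (c : ℝ) :
    InformationTheory.klDiv
      (((Measure.pi fun j => gaussianReal 0 (p j)).prod
        (Measure.pi fun j => gaussianReal 0 (τ j))).map
          (fun x => (x.1, fun j => c * x.1 j + x.2 j)))
      ((Measure.pi fun j => gaussianReal 0 (p j)).prod
        (Measure.pi fun j => gaussianReal 0 (‖c‖₊ ^ 2 * p j + τ j)))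
      ≤ ∑ j, ENNReal.ofReal (1 / 2 * Real.log (1 + c ^ 2 * p j / τ j)) := by
  have hf : Measurable (fun x : ℝ × ℝ => (x.1, c * x.1 + x.2)) := by fun_prop
  have (j : Fin n) : IsProbabilityMeasure (((gaussianReal 0 (p j)).prod
      (gaussianReal 0 (τ j))).map (fun x : ℝ × ℝ => (x.1, c * x.1 + x.2))) :=
    Measure.isProbabilityMeasure_map hf.aemeasurable
  have h := pi_prod_pi_map (fun j => gaussianReal 0 (p j)) (fun j => gaussianReal 0 (τ j))
    (f := fun _ x => (x.1, c * x.1 + x.2)) (fun _ => hf)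
  have hsplit : Measurable (fun w : Fin n → ℝ × ℝ => ((fun j => (w j).1), (fun j => (w j).2))) := by
    fun_prop
  have h₁ : ((Measure.pi fun j => gaussianReal 0 (p j)).prod
        (Measure.pi fun j => gaussianReal 0 (τ j))).map
          (fun x => (x.1, fun j => c * x.1 j + x.2 j)) =
      (Measure.pi fun j => ((gaussianReal 0 (p j)).prod (gaussianReal 0 (τ j))).map
        (fun x : ℝ × ℝ => (x.1, c * x.1 + x.2))).map
          (fun w => ((fun j => (w j).1), (fun j => (w j).2))) := by
    rw [← h, Measure.map_map hsplit (by fun_prop)]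
    rfl
  rw [h₁, pi_prod_pi_eq_map (fun j => gaussianReal 0 (p j))
    (fun j => gaussianReal 0 (‖c‖₊ ^ 2 * p j + τ j))]
  -- Both laws are images, under the same regrouping, of product laws on vectors of pairs; data
  -- processing reduces to those.
  refine (InformationTheory.klDiv_map_le _ _ hsplit).trans
    ((InformationTheory.klDiv_pi_le _ _).trans ?_)
  gcongr with j
  exact klDiv_gaussian_channel_le (p j) (τ j) (hτ j) c

end GaussianVectors
-- Signal, disturbance and output under a deterministic hopping pattern.
section FixedPattern

/-- The law of a sum of independent Gaussian vectors with independent coordinates. -/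
lemma map_sum_gaussianVectors {Ω κ ι : Type*} [MeasurableSpace Ω] [Fintype ι] {μ : Measure Ω}
    [IsProbabilityMeasure μ] {F : κ → Ω → ι → ℝ} (hF : ∀ k, Measurable (F k))
    (hind : iIndepFun F μ) {q : κ → ι → ℝ≥0}
    (hlaw : ∀ k, μ.map (F k) = Measure.pi fun j => gaussianReal 0 (q k j)) (s : Finset κ) :
    μ.map (∑ k ∈ s, F k) = Measure.pi fun j => gaussianReal 0 (∑ k ∈ s, q k j) := by
  classical
  induction s using Finset.induction_on with
  | empty =>
    simp only [Finset.sum_empty, gaussianReal_zero_var]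
    have hdirac : Measure.pi (fun _ : ι => Measure.dirac (0 : ℝ)) = Measure.dirac 0 := by
      refine Measure.pi_eq fun t ht => ?_
      simp_rw [Measure.dirac_apply' _ (ht _), Measure.dirac_apply' _ (MeasurableSet.univ_pi ht),
        Set.indicator_apply, Set.mem_univ_pi, Pi.one_apply, Pi.zero_apply]
      rw [Finset.prod_ite_zero]
      simp
    rw [hdirac]
    exact (Measure.map_const μ (0 : ι → ℝ)).trans (by simp)
  | insert a s ha ih =>
    have hsum : Measurable (∑ k ∈ s, F k) := by
      rw [Finset.sum_fn]
      exact Finset.measurable_sum _ fun k _ => hF k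
    have hI := (hind.indepFun_finsetSum_of_notMem hF ha).symm
    have hpair := hI.map_prod_eq_prod_map_map (hF a).aemeasurable hsum.aemeasurable
    have hadd := gaussianVector_map_mul_add (q a) (fun j => ∑ k ∈ s, q k j) 1
    rw [← ih, ← hlaw a, ← hpair, Measure.map_map (by fun_prop) (by fun_prop)] at hadd
    simp only [Finset.sum_insert ha]
    simpa [Function.comp_def, Pi.add_def] using hadd

variable {N u : ℕ}

/-- The joint law of the Gaussian symbols of all users and of the noise. -/
noncomputable def symbolNoiseMeasure (v : Fin N → ℕ) (P σ : ℝ≥0) :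
    Measure ((Fin N → Fin u → ℝ) × (Fin u → ℝ)) :=
  (Measure.pi fun k => Measure.pi fun _ : Fin u => gaussianReal 0 (P / (v k : ℝ≥0))).prod
      (Measure.pi fun _ : Fin u => gaussianReal 0 (σ ^ 2))

instance (v : Fin N → ℕ) (P σ : ℝ≥0) :
    IsProbabilityMeasure (symbolNoiseMeasure (u := u) v P σ) := by
  unfold symbolNoiseMeasure
  infer_instance

/-- The power that user `k` puts on sub-band `j` when it selects the set `s`. -/
noncomputable def bandPower (v : Fin N → ℕ) (P : ℝ≥0) (k : Fin N) (s : Finset (Fin u))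
    (j : Fin u) : ℝ≥0 :=
  if j ∈ s then P / (v k : ℝ≥0) else 0

/-- The power of noise plus interference on sub-band `j` under the hopping pattern `a`. -/
noncomputable def disturbancePower (v : Fin N → ℕ) (h : Fin N → Fin N → ℝ) (P σ : ℝ≥0)
    (i : Fin N) (a : Fin N → Finset (Fin u)) (j : Fin u) : ℝ≥0 :=
  ∑ k ∈ Finset.univ.erase i, ‖h k i‖₊ ^ 2 * bandPower v P k (a k) j + σ ^ 2

/-- A silent sub-band carries the constant `0`, a Gaussian of variance zero, so masking stays within
products of Gaussians. -/
lemma map_masked_signal (v : Fin N → ℕ) (P : ℝ≥0) (k : Fin N) (s : Finset (Fin u)) (c : ℝ) :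
    (Measure.pi fun _ : Fin u => gaussianReal 0 (P / (v k : ℝ≥0))).map
      (fun x j => c * (if j ∈ s then x j else 0))
      = Measure.pi fun j => gaussianReal 0 (‖c‖₊ ^ 2 * bandPower v P k s j) := by
  have hm : ∀ j : Fin u, Measurable fun x : ℝ => c * (if j ∈ s then x else 0) := by
    intro j
    split_ifs <;> fun_prop
  have (j : Fin u) : IsProbabilityMeasure ((gaussianReal 0 (P / (v k : ℝ≥0))).map
      fun x : ℝ => c * (if j ∈ s then x else 0)) :=
    Measure.isProbabilityMeasure_map (hm j).aemeasurable
  rw [Measure.pi_map_pi (f := fun j x => c * (if j ∈ s then x else 0))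
    fun j => (hm j).aemeasurable]
  congr 1
  funext j
  unfold bandPower
  split_ifs
  · exact gaussianReal_map_mul _ c
  · simp

lemma transmitted_pattern_apply (k : Fin N) (a : Fin N → Finset (Fin u))
    (g : (Fin N → Fin u → ℝ) × (Fin u → ℝ)) (j : Fin u) :
    transmitted k (a, g) j = if j ∈ a k then g.1 k j else 0 :=
  rfl

/-- For a fixed hopping pattern, signal and disturbance are independent Gaussian vectors. -/
lemma map_transmitted_noisePlusInterference (v : Fin N → ℕ) (h : Fin N → Fin N → ℝ) (P σ : ℝ≥0)
    (i : Fin N) (a : Fin N → Finset (Fin u)) :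
    (symbolNoiseMeasure v P σ).map
        (fun g => (transmitted i (a, g), noisePlusInterference h i (a, g)))
      = (Measure.pi fun j => gaussianReal 0 (bandPower v P i (a i) j)).prod
        (Measure.pi fun j => gaussianReal 0 (disturbancePower v h P σ i a j)) := by
  set ξ : Measure (Fin N → Fin u → ℝ) :=
    Measure.pi fun k => Measure.pi fun _ : Fin u => gaussianReal 0 (P / (v k : ℝ≥0)) with hξ
  -- Gain `1` for user `i` makes `F i` the transmitted vector itself, while the other `F k` are the
  -- interference terms. One independent family thus handles both.
  set c : Fin N → ℝ := fun k => if k = i then 1 else h k i with hc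
  have hm : ∀ k, Measurable fun (x : Fin u → ℝ) (j : Fin u) =>
      c k * (if j ∈ a k then x j else 0) := by
    intro k
    refine measurable_pi_lambda _ fun j => ?_
    split_ifs <;> fun_prop
  set F : Fin N → (Fin N → Fin u → ℝ) → Fin u → ℝ :=
    fun k x j => c k * (if j ∈ a k then x k j else 0) with hFdef
  have hF : ∀ k, Measurable (F k) := fun k => (hm k).comp (measurable_pi_apply k)
  have hind : iIndepFun F ξ := iIndepFun_pi fun k => (hm k).aemeasurable
  have hlaw : ∀ k, ξ.map (F k) =
      Measure.pi fun j => gaussianReal 0 (‖c k‖₊ ^ 2 * bandPower v P k (a k) j) := by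
    intro k
    rw [← map_masked_signal, ← (measurePreserving_eval (fun k => Measure.pi fun _ : Fin u =>
      gaussianReal 0 (P / (v k : ℝ≥0))) k).map_eq, Measure.map_map (hm k) (by fun_prop)]
    rfl
  have hsum : Measurable (∑ k ∈ Finset.univ.erase i, F k) :=
    by
      rw [Finset.sum_fn]
      exact Finset.measurable_sum _ fun k _ => hF k
  have hpair := ((hind.indepFun_finsetSum_of_notMem hF
    (Finset.notMem_erase i Finset.univ)).symm).map_prod_eq_prod_map_map
      (hF i).aemeasurable hsum.aemeasurable
  rw [map_sum_gaussianVectors hF hind hlaw, hlaw i] at hpair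
  set nu := Measure.pi fun _ : Fin u => gaussianReal 0 (σ ^ 2) with hnu
  have hadd := gaussianVector_map_mul_add (fun j => ∑ k ∈ Finset.univ.erase i,
    ‖c k‖₊ ^ 2 * bandPower v P k (a k) j) (fun _ => σ ^ 2) 1
  -- The map factors as: form signal and interference while carrying the noise along, reassociate,
  -- then add the noise to the interference.
  have hfun : (fun g : (Fin N → Fin u → ℝ) × (Fin u → ℝ) =>
      (transmitted i (a, g), noisePlusInterference h i (a, g))) =
      (Prod.map id fun x : (Fin u → ℝ) × (Fin u → ℝ) => fun j => 1 * x.1 j + x.2 j) ∘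
        MeasurableEquiv.prodAssoc ∘
          (Prod.map (fun x => (F i x, (∑ k ∈ Finset.univ.erase i, F k) x)) id) := by
    funext g
    refine Prod.ext ?_ ?_
    · funext j
      simp [transmitted_pattern_apply, F, c, MeasurableEquiv.prodAssoc]
    · funext j
      simp only [noisePlusInterference, transmitted_pattern_apply, Function.comp_apply, Prod.map,
        MeasurableEquiv.prodAssoc, MeasurableEquiv.coe_mk, Equiv.prodAssoc_apply, one_mul, id,
        Finset.sum_apply, F]
      congr 1
      refine Finset.sum_congr rfl fun k hk => ?_
      simp [c, Finset.ne_of_mem_erase hk]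
  have hz : (fun j => disturbancePower v h P σ i a j) =
      fun j => ‖(1 : ℝ)‖₊ ^ 2 * (∑ k ∈ Finset.univ.erase i,
        ‖c k‖₊ ^ 2 * bandPower v P k (a k) j) + σ ^ 2 := by
    funext j
    simp only [disturbancePower, nnnorm_one, one_pow, one_mul]
    congr 1
    refine Finset.sum_congr rfl fun k hk => ?_
    simp [c, Finset.ne_of_mem_erase hk]
  have hx : (fun j => ‖c i‖₊ ^ 2 * bandPower v P i (a i) j) = bandPower v P i (a i) := by
    funext j
    simp [c]
  rw [hfun, ← Measure.map_map (by fun_prop) (by fun_prop),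
    ← Measure.map_map (by fun_prop) (by fun_prop)]
  have h1 : (symbolNoiseMeasure v P σ).map
      (Prod.map (fun x => (F i x, (∑ k ∈ Finset.univ.erase i, F k) x)) id) =
      (ξ.map (fun x => (F i x, (∑ k ∈ Finset.univ.erase i, F k) x))).prod (nu.map id) :=
    (Measure.map_prod_map ξ nu ((hF i).prodMk hsum) measurable_id).symm
  rw [h1, hpair, Measure.map_id, Measure.prodAssoc_prod,
    ← Measure.map_prod_map _ _ measurable_id (by fun_prop), hadd, Measure.map_id]
  congr 1
  · congr 1; funext j; rw [congrFun hx j]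
  · congr 1; funext j; rw [← congrFun hz j]

lemma measurable_transmitted_pattern (i : Fin N) (a : Fin N → Finset (Fin u)) :
    Measurable fun g : (Fin N → Fin u → ℝ) × (Fin u → ℝ) => transmitted i (a, g) := by
  refine measurable_pi_lambda _ fun j => ?_
  simp only [transmitted_pattern_apply]
  split_ifs <;> fun_prop

lemma measurable_noisePlusInterference_pattern (h : Fin N → Fin N → ℝ) (i : Fin N)
    (a : Fin N → Finset (Fin u)) :
    Measurable fun g : (Fin N → Fin u → ℝ) × (Fin u → ℝ) => noisePlusInterference h i (a, g) := by
  refine measurable_pi_lambda _ fun j => ?_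
  have (k : Fin N) := (measurable_pi_apply j).comp (measurable_transmitted_pattern k a)
  simp only [Function.comp_def] at this
  unfold noisePlusInterference
  fun_prop

lemma measurable_received_pattern (h : Fin N → Fin N → ℝ) (i : Fin N)
    (a : Fin N → Finset (Fin u)) :
    Measurable fun g : (Fin N → Fin u → ℝ) × (Fin u → ℝ) => received h i (a, g) := by
  refine measurable_pi_lambda _ fun j => ?_
  have h₁ := (measurable_pi_apply j).comp (measurable_transmitted_pattern i a)
  have h₂ := (measurable_pi_apply j).comp (measurable_noisePlusInterference_pattern h i a)
  simp only [Function.comp_def] at h₁ h₂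
  unfold received
  fun_prop

lemma map_transmitted_pattern (v : Fin N → ℕ) (P σ : ℝ≥0) (i : Fin N)
    (a : Fin N → Finset (Fin u)) :
    (symbolNoiseMeasure v P σ).map (fun g => transmitted i (a, g))
      = Measure.pi fun j => gaussianReal 0 (bandPower v P i (a i) j) := by
  -- The transmitted vector does not involve the gains, so they may be taken to be zero.
  have h := congrArg (Measure.map Prod.fst)
    (map_transmitted_noisePlusInterference v (fun _ _ => 0) P σ i a)
  rw [Measure.map_map measurable_fst ((measurable_transmitted_pattern i a).prodMk
    (measurable_noisePlusInterference_pattern _ i a))] at h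
  refine Eq.trans h ?_
  exact Measure.fst_prod

/-- Bound for the mutual information between signal and output for a fixed hopping pattern. -/
lemma klDiv_pattern_le (v : Fin N → ℕ) (h : Fin N → Fin N → ℝ) (P σ : ℝ≥0) (hσ : 0 < σ)
    (i : Fin N) (a : Fin N → Finset (Fin u)) :
    InformationTheory.klDiv
      ((symbolNoiseMeasure v P σ).map (fun g => (transmitted i (a, g), received h i (a, g))))
      (((symbolNoiseMeasure v P σ).map (fun g => transmitted i (a, g))).prod
        ((symbolNoiseMeasure v P σ).map (fun g => received h i (a, g))))
      ≤ ∑ j, ENNReal.ofReal (1 / 2 * Real.log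
        (1 + h i i ^ 2 * bandPower v P i (a i) j / disturbancePower v h P σ i a j)) := by
  have hXZ := map_transmitted_noisePlusInterference v h P σ i a
  have hm := (measurable_transmitted_pattern i a).prodMk
    (measurable_noisePlusInterference_pattern h i a)
  have hτ : ∀ j, disturbancePower v h P σ i a j ≠ 0 := by
    intro j
    unfold disturbancePower
    positivity
  have hXY : (symbolNoiseMeasure v P σ).map
      (fun g => (transmitted i (a, g), received h i (a, g))) =
      ((Measure.pi fun j => gaussianReal 0 (bandPower v P i (a i) j)).prod
        (Measure.pi fun j => gaussianReal 0 (disturbancePower v h P σ i a j))).map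
          (fun x => (x.1, fun j => h i i * x.1 j + x.2 j)) := by
    rw [← hXZ, Measure.map_map (by fun_prop) hm]
    rfl
  have hY : (symbolNoiseMeasure v P σ).map (fun g => received h i (a, g)) =
      Measure.pi fun j => gaussianReal 0
        (‖h i i‖₊ ^ 2 * bandPower v P i (a i) j + disturbancePower v h P σ i a j) := by
    rw [← gaussianVector_map_mul_add (bandPower v P i (a i)) (disturbancePower v h P σ i a),
      ← hXZ, Measure.map_map (by fun_prop) hm]
    rfl
  rw [hXY, hY, map_transmitted_pattern]
  exact klDiv_parallel_gaussian_channels_le _ _ hτ _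

end FixedPattern
-- Averaging over random hopping patterns.
section Mixture

instance (u : ℕ) : DiscreteMeasurableSpace (Finset (Fin u)) := ⟨fun _ => trivial⟩

/-- An image of a product measure with finite first factor is a finite mixture. -/
lemma map_prod_eq_sum_smul {A G β : Type*} [Fintype A] [MeasurableSpace A]
    [MeasurableSingletonClass A] [MeasurableSpace G] [MeasurableSpace β] (π : Measure A)
    [IsFiniteMeasure π] (γ : Measure G) [IsFiniteMeasure γ] {Φ : A × G → β}
    (hΦ : ∀ a, Measurable fun g => Φ (a, g)) :
    (π.prod γ).map Φ = ∑ a, (π {a}).toNNReal • γ.map (fun g => Φ (a, g)) := by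
  have hm : Measurable Φ := measurable_from_prod_countable_right hΦ
  ext s hs
  rw [Measure.map_apply hm hs, Measure.prod_apply (hm hs), lintegral_fintype,
    Measure.finsetSum_apply]
  refine Finset.sum_congr rfl fun a _ => ?_
  rw [Measure.smul_apply, Measure.map_apply (hΦ a) hs, ENNReal.smul_def, smul_eq_mul,
    ENNReal.coe_toNNReal (measure_ne_top _ _), mul_comm]
  rfl

lemma prod_sum_smul {A α β : Type*} [MeasurableSpace α] [MeasurableSpace β] (s : Finset A)
    (ρ : Measure α) [IsFiniteMeasure ρ] (w : A → ℝ≥0) (μ : A → Measure β)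
    [∀ a, IsFiniteMeasure (μ a)] :
    ρ.prod (∑ a ∈ s, w a • μ a) = ∑ a ∈ s, w a • ρ.prod (μ a) := by
  classical
  induction s using Finset.induction_on with
  | empty => simp
  | insert a s ha ih =>
    rw [Finset.sum_insert ha, Finset.sum_insert ha, Measure.prod_add, ih]
    congr 1
    exact Measure.prod_smul_right (w a : ℝ≥0∞)

/-- Conditioning on `S_i = s` thus only replaces the pattern law, so `mutualInfo_le_sum_patternRate`
applies to the conditional measure. -/
lemma cond_prod_univ {A G : Type*} [MeasurableSpace A] [MeasurableSpace G] (π : Measure A)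
    [IsFiniteMeasure π] (γ : Measure G) [IsProbabilityMeasure γ] (E : Set A) :
    ProbabilityTheory.cond (π.prod γ) (E ×ˢ Set.univ) = (ProbabilityTheory.cond π E).prod γ := by
  rw [ProbabilityTheory.cond, ProbabilityTheory.cond, Measure.prod_prod, measure_univ, mul_one,
    ← Measure.prod_restrict, Measure.restrict_univ, Measure.prod_smul_left]

variable {N u : ℕ}

/-- The Gaussian rate in nats for a known hopping pattern, summed over the sub-bands. -/
noncomputable def patternRate (v : Fin N → ℕ) (h : Fin N → Fin N → ℝ) (P σ : ℝ≥0) (i : Fin N)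
    (a : Fin N → Finset (Fin u)) : ℝ≥0∞ :=
  ∑ j, ENNReal.ofReal (1 / 2 * Real.log
    (1 + h i i ^ 2 * bandPower v P i (a i) j / disturbancePower v h P σ i a j))

/-- Revealing the hopping pattern to the receiver does not decrease the mutual information. -/
lemma mutualInfo_le_sum_patternRate (v : Fin N → ℕ) (h : Fin N → Fin N → ℝ) (P σ : ℝ≥0)
    (hσ : 0 < σ) (i : Fin N) (s : Finset (Fin u)) (π : Measure (Fin N → Finset (Fin u)))
    [IsProbabilityMeasure π] (hπ : ∀ a, π {a} ≠ 0 → a i = s) :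
    mutualInfo (π.prod (symbolNoiseMeasure v P σ)) (transmitted i) (received h i)
      ≤ (∑ a, π {a} * patternRate v h P σ i a) / ENNReal.ofReal (Real.log 2) := by
  unfold mutualInfo
  refine ENNReal.div_le_div_right ?_ _
  set γ := symbolNoiseMeasure (u := u) v P σ
  have hX := measurable_transmitted_pattern (N := N) (u := u) i
  have hY := measurable_received_pattern (N := N) (u := u) h i
  set Q : Measure (Fin u → ℝ) := Measure.pi fun j => gaussianReal 0 (bandPower v P i s j) with hQ
  have hw : ∑ a, π {a} = 1 := by
    rw [sum_measure_singleton]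
    simp
  have hwn : ∑ a, (π {a}).toNNReal = 1 := by
    rw [← ENNReal.toNNReal_sum fun a _ => measure_ne_top _ _, hw]
    simp
  -- Every pattern of positive weight has the same `a i`, hence the same input law `Q`. This lets
  -- the product of the marginals be a mixture with the weights of the joint law.
  have hQa : ∀ a, π {a} ≠ 0 → γ.map (fun g => transmitted i (a, g)) = Q := by
    intro a ha
    rw [map_transmitted_pattern, hπ a ha]
  have hmapX : (π.prod γ).map (transmitted i) = Q := by
    rw [map_prod_eq_sum_smul π γ hX]
    have : ∀ a ∈ Finset.univ, (π {a}).toNNReal • γ.map (fun g => transmitted i (a, g)) =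
        (π {a}).toNNReal • Q := by
      intro a _
      by_cases ha : π {a} = 0
      · simp [ha]
      · rw [hQa a ha]
    rw [Finset.sum_congr rfl this, ← Finset.sum_smul, hwn, one_smul]
  have (a : Fin N → Finset (Fin u)) : IsProbabilityMeasure (γ.map fun g => received h i (a, g)) :=
    Measure.isProbabilityMeasure_map (hY a).aemeasurable
  have (a : Fin N → Finset (Fin u)) : IsProbabilityMeasure
      (γ.map fun g => (transmitted i (a, g), received h i (a, g))) :=
    Measure.isProbabilityMeasure_map ((hX a).prodMk (hY a)).aemeasurable
  rw [hmapX, map_prod_eq_sum_smul π γ hY, prod_sum_smul,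
    map_prod_eq_sum_smul π γ (Φ := fun ω => (transmitted i ω, received h i ω))
      fun a => (hX a).prodMk (hY a)]
  refine (InformationTheory.klDiv_sum_smul_le _ _ _ _).trans (Finset.sum_le_sum fun a _ => ?_)
  rw [ENNReal.coe_toNNReal (measure_ne_top _ _)]
  by_cases ha : π {a} = 0
  · simp [ha]
  · gcongr
    rw [← hQa a ha]
    exact klDiv_pattern_le v h P σ hσ i a

/-- The law of the hopping patterns of all users. -/
noncomputable def hoppingMeasure (u : ℕ) (v : Fin N → ℕ) : Measure (Fin N → Finset (Fin u)) :=
  Measure.pi fun k => uniformOn {s : Finset (Fin u) | s.card = v k}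

lemma isProbabilityMeasure_uniformOn_card {u m : ℕ} (hm : m ≤ u) :
    IsProbabilityMeasure (uniformOn {s : Finset (Fin u) | s.card = m}) := by
  obtain ⟨t, -, ht⟩ := Finset.exists_subset_card_eq
    (show m ≤ (Finset.univ : Finset (Fin u)).card by simpa using hm)
  exact isProbabilityMeasure_uniformOn (Set.toFinite _) ⟨t, ht⟩

/-- The achievable rate is at most the average rate with a receiver informed of the pattern. -/
lemma achievableRate_le_sum_patternRate (v : Fin N → ℕ) (hv : ∀ k, v k ≤ u)
    (h : Fin N → Fin N → ℝ) (P σ : ℝ≥0) (hσ : 0 < σ) (i : Fin N) :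
    achievableRate u v h P σ i ≤
      (∑ a, hoppingMeasure u v {a} * patternRate v h P σ i a) / ENNReal.ofReal (Real.log 2) := by
  have (k : Fin N) := isProbabilityMeasure_uniformOn_card (hv k)
  have : IsProbabilityMeasure (hoppingMeasure u v) := by
    unfold hoppingMeasure
    infer_instance
  set π := hoppingMeasure u v
  set γ := symbolNoiseMeasure (u := u) v P σ
  have hslot : slotMeasure v P σ = π.prod γ := rfl
  unfold achievableRate condMutualInfo
  rw [hslot]
  have hstep : ∀ s : Finset (Fin u), (π.prod γ) (hopping i ⁻¹' {s}) *
      mutualInfo (ProbabilityTheory.cond (π.prod γ) (hopping i ⁻¹' {s})) (transmitted i)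
        (received h i) ≤
      (∑ a, (if a i = s then π {a} else 0) * patternRate v h P σ i a) /
        ENNReal.ofReal (Real.log 2) := by
    intro s
    set E : Set (Fin N → Finset (Fin u)) := {a | a i = s} with hE
    have hpre : (hopping i ⁻¹' {s} : Set (Slot N u)) = E ×ˢ Set.univ := by
      ext ω
      simp [hopping, hE]
    have hEm : MeasurableSet E := E.toFinite.measurableSet
    rw [hpre, cond_prod_univ, Measure.prod_prod, measure_univ, mul_one]
    by_cases h0 : π E = 0
    · simp [h0]
    have := cond_isProbabilityMeasure h0
    refine (mul_le_mul_right (mutualInfo_le_sum_patternRate v h P σ hσ i s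
      (ProbabilityTheory.cond π E) ?_) _).trans ?_
    · intro a ha
      by_contra hne
      refine ha ?_
      rw [cond_apply hEm]
      have : E ∩ {a} = ∅ := by
        ext b
        simp only [Set.mem_inter_iff, Set.mem_singleton_iff, Set.mem_empty_iff_false, iff_false]
        rintro ⟨hb, rfl⟩
        exact hne hb
      simp [this]
    · rw [← mul_div_assoc, Finset.mul_sum]
      refine ENNReal.div_le_div_right (Finset.sum_le_sum fun a _ => ?_) _
      -- The weight `π E` cancels the normalisation of the conditional law.
      rw [← mul_assoc, cond_apply hEm, ← mul_assoc, ENNReal.mul_inv_cancel h0 (measure_ne_top _ _),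
        one_mul]
      refine mul_le_mul_left ?_ _
      split_ifs with has
      · exact measure_mono Set.inter_subset_right
      · have : E ∩ {a} = ∅ := by
          ext b
          simp only [Set.mem_inter_iff, Set.mem_singleton_iff, Set.mem_empty_iff_false, iff_false]
          rintro ⟨hb, rfl⟩
          exact has hb
        simp [this]
  -- Each pattern `a` is counted for exactly one `s`, namely `a i`.
  refine (Finset.sum_le_sum fun s _ => hstep s).trans (le_of_eq ?_)
  simp_rw [div_eq_mul_inv]
  rw [← Finset.sum_mul, Finset.sum_comm]
  congr 1
  refine Finset.sum_congr rfl fun a _ => ?_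
  rw [← Finset.sum_mul, Finset.sum_ite_eq]
  simp

end Mixture
-- Probability that a sub-band is used without interference.
section CollisionProbability

/-- A uniformly random set of `m` out of `u` sub-bands avoids a given one with probability
`1 - m / u`. -/
lemma uniformOn_card_real_notMem {u m : ℕ} (hm : m ≤ u) (j : Fin u) :
    (uniformOn {s : Finset (Fin u) | s.card = m}).real {t | j ∉ t} = 1 - (m : ℝ) / u := by
  obtain ⟨n, rfl⟩ : ∃ n, u = n + 1 := ⟨u - 1, by have := j.pos; omega⟩
  have hs : {s : Finset (Fin (n + 1)) | s.card = m} =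
      ((Finset.univ.powersetCard m : Finset (Finset (Fin (n + 1)))) : Set _) := by
    ext s
    simp
  have ht : {t : Finset (Fin (n + 1)) | j ∉ t} =
      ((Finset.univ.filter fun t => j ∉ t : Finset (Finset (Fin (n + 1)))) : Set _) := by
    ext s
    simp
  have hinter : Finset.univ.powersetCard m ∩ Finset.univ.filter (fun t => j ∉ t) =
      (Finset.univ.erase j).powersetCard m := by
    ext t
    simp only [Finset.mem_inter, Finset.mem_powersetCard, Finset.subset_univ, true_and,
      Finset.mem_filter, Finset.mem_univ, Finset.subset_erase]
    tauto
  rw [hs, ht, measureReal_def, uniformOn_apply_finset, hinter, Finset.card_powersetCard,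
    Finset.card_powersetCard, Finset.card_erase_of_mem (Finset.mem_univ j), Finset.card_univ,
    Fintype.card_fin, Nat.add_sub_cancel, ENNReal.toReal_div, ENNReal.toReal_natCast,
    ENNReal.toReal_natCast]
  have hpos : (0 : ℝ) < (n + 1).choose m := by exact_mod_cast Nat.choose_pos hm
  -- The `m`-sets avoiding `j` number `n.choose m`; this identity evaluates their proportion among
  -- all `(n + 1).choose m`.
  have hid : (n.choose m : ℝ) * (n + 1) = (n + 1).choose m * (n + 1 - m) := by
    have h := Nat.choose_mul_succ_eq n m
    have h' : ((n.choose m * (n + 1) : ℕ) : ℝ) = (((n + 1).choose m * (n + 1 - m) : ℕ) : ℝ) := by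
      rw [h]
    push_cast [Nat.cast_sub hm] at h'
    exact h'
  push_cast
  field_simp
  linarith

lemma uniformOn_card_real_mem {u m : ℕ} (hm : m ≤ u) (j : Fin u) :
    (uniformOn {s : Finset (Fin u) | s.card = m}).real {t | j ∈ t} = (m : ℝ) / u := by
  have := isProbabilityMeasure_uniformOn_card hm
  have hc : {t : Finset (Fin u) | j ∈ t} = {t | j ∉ t}ᶜ := by
    ext t
    simp
  rw [hc, probReal_compl_eq_one_sub (Set.toFinite _).measurableSet,
    uniformOn_card_real_notMem hm j]
  ring

variable {N u : ℕ}

/-- The hopping patterns for which user `i` uses sub-band `j` without interference. -/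
def collisionFree (i : Fin N) (j : Fin u) : Set (Fin N → Finset (Fin u)) :=
  {a | j ∈ a i ∧ ∀ k, k ≠ i → j ∉ a k}

/-- The event is a box in the independent patterns, so its probability is a product over users. -/
lemma hoppingMeasure_real_collisionFree (v : Fin N → ℕ) (hv : ∀ k, v k ≤ u) (i : Fin N)
    (j : Fin u) : (hoppingMeasure u v).real (collisionFree i j) =
      (v i : ℝ) / u * ∏ k ∈ Finset.univ.erase i, (1 - (v k : ℝ) / u) := by
  have (k : Fin N) := isProbabilityMeasure_uniformOn_card (hv k)
  have hset : collisionFree i j =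
      Set.univ.pi fun k => if k = i then {t : Finset (Fin u) | j ∈ t} else {t | j ∉ t} := by
    ext a
    simp only [collisionFree, Set.mem_ofPred_eq, Set.mem_univ_pi]
    constructor
    · rintro ⟨h₁, h₂⟩ k
      split_ifs with hk
      · subst hk; exact h₁
      · exact h₂ k hk
    · intro h
      refine ⟨by simpa using h i, fun k hk => by simpa [hk] using h k⟩
  rw [hset, hoppingMeasure, measureReal_def, Measure.pi_pi, ENNReal.toReal_prod,
    ← Finset.mul_prod_erase _ _ (Finset.mem_univ i), if_pos rfl]
  congr 1
  · exact uniformOn_card_real_mem (hv i) j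
  · refine Finset.prod_congr rfl fun k hk => ?_
    rw [if_neg (Finset.ne_of_mem_erase hk)]
    exact uniformOn_card_real_notMem (hv k) j

end CollisionProbability

/-! ### Rate per sub-band and its expectation. -/

section UpperBound

variable {N u : ℕ}

/-- A bound, uniform in the powers, for the rate in nats on a sub-band with interference. -/
noncomputable def interferenceRateBound (v : Fin N → ℕ) (h : Fin N → Fin N → ℝ) (i : Fin N) : ℝ :=
  ∑ k ∈ Finset.univ.erase i, 1 / 2 * Real.log (1 + h i i ^ 2 * v k / (h k i ^ 2 * v i))

lemma half_log_one_add_nonneg {x : ℝ} (hx : 0 ≤ x) : 0 ≤ 1 / 2 * Real.log (1 + x) :=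
  mul_nonneg (by norm_num) (Real.log_nonneg (by linarith))

lemma interferenceRateBound_nonneg (v : Fin N → ℕ) (h : Fin N → Fin N → ℝ) (i : Fin N) :
    0 ≤ interferenceRateBound v h i :=
  Finset.sum_nonneg fun _ _ => half_log_one_add_nonneg (by positivity)

/-- Nonzero cross gains are essential here: under interference, signal and disturbance both scale
with `P`, so their ratio stays bounded. -/
lemma bandRate_le (v : Fin N → ℕ) (hv : ∀ k, 1 ≤ v k) (h : Fin N → Fin N → ℝ) (i : Fin N)
    (hcross : ∀ k, k ≠ i → h k i ≠ 0) (P σ : ℝ≥0) (hP : 0 < P) (hσ : 0 < σ)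
    (a : Fin N → Finset (Fin u)) (j : Fin u) :
    1 / 2 * Real.log (1 + h i i ^ 2 * bandPower v P i (a i) j / disturbancePower v h P σ i a j) ≤
      (collisionFree i j).indicator
        (fun _ => 1 / 2 * Real.log (1 + |h i i| ^ 2 * ((P : ℝ) / (σ : ℝ) ^ 2) / v i)) a +
        interferenceRateBound v h i := by
  have hC := interferenceRateBound_nonneg v h i
  have hvi : (0 : ℝ) < v i := by exact_mod_cast hv i
  have hP' : (0 : ℝ) < P := by exact_mod_cast hP
  have hσ' : (0 : ℝ) < σ := by exact_mod_cast hσ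
  have hΛ := half_log_one_add_nonneg
    (show 0 ≤ |h i i| ^ 2 * ((P : ℝ) / (σ : ℝ) ^ 2) / v i by positivity)
  by_cases hj : j ∈ a i
  swap
  · have : bandPower v P i (a i) j = 0 := by simp [bandPower, hj]
    simp only [this, NNReal.coe_zero, mul_zero, zero_div, add_zero, Real.log_one]
    exact add_nonneg (Set.indicator_nonneg (fun _ _ => hΛ) _) hC
  have hb : (bandPower v P i (a i) j : ℝ) = P / v i := by simp [bandPower, hj]
  by_cases hfree : a ∈ collisionFree i j
  · have hd : (disturbancePower v h P σ i a j : ℝ) = (σ : ℝ) ^ 2 := by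
      have : disturbancePower v h P σ i a j = σ ^ 2 := by
        unfold disturbancePower
        rw [Finset.sum_eq_zero, zero_add]
        intro k hk
        simp [bandPower, hfree.2 k (Finset.ne_of_mem_erase hk)]
      simp [this]
    rw [Set.indicator_of_mem hfree, hb, hd, sq_abs]
    refine le_add_of_le_of_nonneg (le_of_eq ?_) hC
    congr 3
    field_simp
  · rw [Set.indicator_of_notMem hfree, zero_add]
    obtain ⟨k, hk, hjk⟩ : ∃ k, k ≠ i ∧ j ∈ a k := by
      simp only [collisionFree, Set.mem_ofPred_eq, not_and, not_forall, not_not] at hfree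
      obtain ⟨k, hk, hjk⟩ := hfree hj
      exact ⟨k, hk, hjk⟩
    have hvk : (0 : ℝ) < v k := by exact_mod_cast hv k
    have hhk := hcross k hk
    -- A single interferer already suffices; the noise and the other users are dropped.
    have hd : h k i ^ 2 * (P / v k) ≤ (disturbancePower v h P σ i a j : ℝ) := by
      have h₁ : ‖h k i‖₊ ^ 2 * bandPower v P k (a k) j ≤ disturbancePower v h P σ i a j := by
        unfold disturbancePower
        exact le_add_right (Finset.single_le_sum
          (f := fun k => ‖h k i‖₊ ^ 2 * bandPower v P k (a k) j) (fun _ _ => zero_le)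
          (Finset.mem_erase.2 ⟨hk, Finset.mem_univ k⟩))
      have h₂ := NNReal.coe_le_coe.2 h₁
      simpa [bandPower, hjk] using h₂
    have hterm : 1 / 2 * Real.log
        (1 + h i i ^ 2 * bandPower v P i (a i) j / disturbancePower v h P σ i a j) ≤
        1 / 2 * Real.log (1 + h i i ^ 2 * v k / (h k i ^ 2 * v i)) := by
      have hle : h i i ^ 2 * bandPower v P i (a i) j / disturbancePower v h P σ i a j ≤
          h i i ^ 2 * v k / (h k i ^ 2 * v i) := by
        rw [hb]
        calc h i i ^ 2 * (P / v i) / disturbancePower v h P σ i a j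
            ≤ h i i ^ 2 * (P / v i) / (h k i ^ 2 * (P / v k)) := by gcongr
          _ = h i i ^ 2 * v k / (h k i ^ 2 * v i) := by field_simp
      gcongr
    refine hterm.trans ?_
    -- Summing over all possible interferers gives a bound independent of which `k` is present.
    exact Finset.single_le_sum
      (f := fun k => 1 / 2 * Real.log (1 + h i i ^ 2 * v k / (h k i ^ 2 * v i)))
      (fun _ _ => half_log_one_add_nonneg (by positivity))
      (Finset.mem_erase.2 ⟨hk, Finset.mem_univ k⟩)

lemma sum_hoppingMeasure_mul_patternRate_le (v : Fin N → ℕ) (hv : ∀ k, 1 ≤ v k ∧ v k ≤ u)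
    (h : Fin N → Fin N → ℝ) (i : Fin N) (hcross : ∀ k, k ≠ i → h k i ≠ 0) (P σ : ℝ≥0)
    (hP : 0 < P) (hσ : 0 < σ) :
    ∑ a, hoppingMeasure u v {a} * patternRate v h P σ i a ≤
      ENNReal.ofReal (multiplexingGain u v i *
        Real.log (1 + |h i i| ^ 2 * ((P : ℝ) / (σ : ℝ) ^ 2) / v i) +
          u * interferenceRateBound v h i) := by
  have (k : Fin N) := isProbabilityMeasure_uniformOn_card (hv k).2
  have hprob : IsProbabilityMeasure (hoppingMeasure u v) := by
    unfold hoppingMeasure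
    infer_instance
  set π := hoppingMeasure u v
  set C := interferenceRateBound v h i
  set L := 1 / 2 * Real.log (1 + |h i i| ^ 2 * ((P : ℝ) / (σ : ℝ) ^ 2) / v i) with hL_def
  have hC : 0 ≤ C := interferenceRateBound_nonneg v h i
  have hL : 0 ≤ L := half_log_one_add_nonneg (by positivity)
  have hind : ∀ (j : Fin u) a, 0 ≤ (collisionFree i j).indicator (fun _ => L) a := fun j a =>
    Set.indicator_nonneg (fun _ _ => hL) a
  have hrate : ∀ a : Fin N → Finset (Fin u), patternRate v h P σ i a ≤
      ENNReal.ofReal (∑ j, ((collisionFree i j).indicator (fun _ => L) a + C)) := by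
    intro a
    rw [ENNReal.ofReal_sum_of_nonneg fun j _ => add_nonneg (hind j a) hC]
    exact Finset.sum_le_sum fun j _ => ENNReal.ofReal_le_ofReal
      (bandRate_le v (fun k => (hv k).1) h i hcross P σ hP hσ a j)
  have hu : (u : ℝ) ≠ 0 := by
    have := (hv i).1.trans (hv i).2
    positivity
  calc ∑ a, π {a} * patternRate v h P σ i a
      ≤ ∑ a, ENNReal.ofReal (π.real {a} *
          ∑ j, ((collisionFree i j).indicator (fun _ => L) a + C)) := by
        refine Finset.sum_le_sum fun a _ => ?_
        rw [ENNReal.ofReal_mul measureReal_nonneg, ofReal_measureReal]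
        gcongr
        exact hrate a
    _ = ENNReal.ofReal (∑ a, π.real {a} *
          ∑ j, ((collisionFree i j).indicator (fun _ => L) a + C)) := by
        rw [ENNReal.ofReal_sum_of_nonneg]
        intro a _
        exact mul_nonneg measureReal_nonneg
          (Finset.sum_nonneg fun j _ => add_nonneg (hind j a) hC)
    _ = _ := by
        congr 1
        have hint : ∑ a, π.real {a} * ∑ j, ((collisionFree i j).indicator (fun _ => L) a + C) =
            ∑ j : Fin u, ∫ a, ((collisionFree i j).indicator (fun _ => L) a + C) ∂π := by
          simp_rw [Finset.mul_sum]
          rw [Finset.sum_comm]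
          refine Finset.sum_congr rfl fun j _ => ?_
          rw [integral_fintype .of_finite]
          rfl
        rw [hint]
        have hj : ∀ j : Fin u, ∫ a, ((collisionFree i j).indicator (fun _ => L) a + C) ∂π =
            (v i : ℝ) / u * (∏ k ∈ Finset.univ.erase i, (1 - (v k : ℝ) / u)) * L + C := by
          intro j
          rw [integral_add .of_finite .of_finite,
            integral_indicator_const _ (Set.toFinite _).measurableSet,
            hoppingMeasure_real_collisionFree v (fun k => (hv k).2)]
          simp
        simp only [hj, Finset.sum_const, Finset.card_univ, Fintype.card_fin, nsmul_eq_mul]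
        -- The number `u` of sub-bands cancels the denominator of `v i / u`, and the `1/2` in `L`
        -- becomes that of the gain.
        rw [hL_def, multiplexingGain]
        field_simp

end UpperBound

/-! ### Growth of the bound at high signal-to-noise ratio. -/

section Asymptotics

/-- For `x > 1`, `log (1 + c x) = log x + log (1/x + c)`, and the last term converges to `log c`. -/
lemma tendsto_logb_one_add_mul_div_logb {c : ℝ} (hc : 0 < c) :
    Tendsto (fun x : ℝ => Real.logb 2 (1 + c * x) / Real.logb 2 x) atTop (𝓝 1) := by
  have hlog : Tendsto (fun x : ℝ => Real.log x) atTop atTop := Real.tendsto_log_atTop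
  have h₁ : Tendsto (fun x : ℝ => Real.log (x⁻¹ + c)) atTop (𝓝 (Real.log c)) := by
    have h := (tendsto_inv_atTop_zero (𝕜 := ℝ)).add_const c
    rw [zero_add] at h
    exact h.log hc.ne'
  have h₂ := (h₁.div_atTop hlog).const_add 1
  rw [add_zero] at h₂
  refine h₂.congr' ?_
  filter_upwards [eventually_gt_atTop 1] with x hx
  have hx0 : 0 < x := by linarith
  have hlx : Real.log x ≠ 0 := (Real.log_pos hx).ne'
  have hl2 : Real.log 2 ≠ 0 := (Real.log_pos one_lt_two).ne'
  have hmul : Real.log (1 + c * x) = Real.log x + Real.log (x⁻¹ + c) := by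
    rw [← Real.log_mul hx0.ne' (by positivity)]
    congr 1
    field_simp
  rw [Real.logb, Real.logb, hmul]
  field_simp

lemma tendsto_rateUpperBound_div_logb {N u : ℕ} (v : Fin N → ℕ) (hv : ∀ k, 1 ≤ v k)
    (h : Fin N → Fin N → ℝ) (i : Fin N) (hi : h i i ≠ 0) {Rt : ℝ → ℝ} {L : ℝ}
    (hRt : Tendsto Rt atTop (𝓝 L)) :
    Tendsto (fun γ : ℝ => rateUpperBound u v h i Rt γ / Real.logb 2 γ) atTop
      (𝓝 (multiplexingGain u v i)) := by
  have hvi : (0 : ℝ) < v i := by exact_mod_cast hv i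
  have hc : 0 < |h i i| ^ 2 / (v i : ℝ) := by positivity
  have h₁ := (tendsto_logb_one_add_mul_div_logb hc).const_mul (multiplexingGain u v i)
  have h₂ := hRt.div_atTop (Real.tendsto_logb_atTop (b := 2) one_lt_two)
  have h₃ := h₁.add h₂
  rw [mul_one, add_zero] at h₃
  refine h₃.congr fun γ => ?_
  rw [rateUpperBound, add_div, mul_div_assoc, div_mul_eq_mul_div]

/-- Strictness matters: an interferer with `v k = u` occupies every sub-band and makes the gain
vanish. -/
lemma multiplexingGain_pos {N u : ℕ} (v : Fin N → ℕ) (i : Fin N) (hvi : 1 ≤ v i)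
    (hv : ∀ k, k ≠ i → v k < u) : 0 < multiplexingGain u v i := by
  have hvi' : (0 : ℝ) < v i := by exact_mod_cast hvi
  refine mul_pos (by positivity) (Finset.prod_pos fun k hk => ?_)
  have hk' := hv k (Finset.ne_of_mem_erase hk)
  have hu : (0 : ℝ) < u := by exact_mod_cast (Nat.zero_le _).trans_lt hk'
  rw [sub_pos, div_lt_one hu]
  exact_mod_cast hk'

end Asymptotics

/-! ### Assembly of the bound in bits. -/

lemma achievableRate_le_ofReal_rateUpperBound {N u : ℕ} (v : Fin N → ℕ)
    (hv : ∀ k, 1 ≤ v k ∧ v k ≤ u) (h : Fin N → Fin N → ℝ) (i : Fin N)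
    (hcross : ∀ k, k ≠ i → h k i ≠ 0) (P σ : ℝ≥0) (hP : 0 < P) (hσ : 0 < σ) :
    achievableRate u v h P σ i ≤ ENNReal.ofReal (rateUpperBound u v h i
      (fun _ => u * interferenceRateBound v h i / Real.log 2) ((P : ℝ) / (σ : ℝ) ^ 2)) := by
  refine (achievableRate_le_sum_patternRate v (fun k => (hv k).2) h P σ hσ i).trans
    ((ENNReal.div_le_div_right
      (sum_hoppingMeasure_mul_patternRate_le v hv h i hcross P σ hP hσ) _).trans (le_of_eq ?_))
  rw [← ENNReal.ofReal_div_of_pos (Real.log_pos one_lt_two), rateUpperBound, Real.logb,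
    add_div, mul_div_assoc]

/-- Needed to pass from the `ENNReal.ofReal` bound to real numbers. -/
lemma rateUpperBound_nonneg {N u : ℕ} (v : Fin N → ℕ) (hv : ∀ k, v k ≤ u)
    (h : Fin N → Fin N → ℝ) (i : Fin N) {Rt : ℝ → ℝ} {γ : ℝ} (hγ : 0 ≤ γ) (hRt : 0 ≤ Rt γ) :
    0 ≤ rateUpperBound u v h i Rt γ := by
  have hgain : 0 ≤ multiplexingGain u v i := by
    refine mul_nonneg (by positivity) (Finset.prod_nonneg fun k _ => sub_nonneg.2 ?_)
    exact div_le_one_of_le₀ (by exact_mod_cast hv k) (by positivity)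
  have hlog : 0 ≤ Real.logb 2 (1 + |h i i| ^ 2 * γ / (v i : ℝ)) :=
    Real.logb_nonneg one_lt_two (le_add_of_nonneg_right (by positivity))
  exact add_nonneg (mul_nonneg hgain hlog) hRt

end FrequencyHopping

theorem theorem1 (N u : ℕ) (v : Fin N → ℕ) (hv : ∀ k, 1 ≤ v k ∧ v k ≤ u)
    (h : Fin N → Fin N → ℝ) (i : Fin N) (hcross : ∀ k, k ≠ i → h k i ≠ 0) :
    ∃ Rt : ℝ → ℝ,
      (∃ L : ℝ, Tendsto Rt atTop (𝓝 L)) ∧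
      (∀ P σ : ℝ≥0, 0 < P → 0 < σ →
        FrequencyHopping.achievableRate u v h P σ i ≠ ⊤ ∧
        (FrequencyHopping.achievableRate u v h P σ i).toReal ≤
          FrequencyHopping.rateUpperBound u v h i Rt ((P : ℝ) / (σ : ℝ) ^ 2)) ∧
      (h i i ≠ 0 →
        Tendsto (fun γ : ℝ => FrequencyHopping.rateUpperBound u v h i Rt γ / Real.logb 2 γ)
          atTop (𝓝 (FrequencyHopping.multiplexingGain u v i)) ∧
        ((∀ k, k ≠ i → v k < u) →
          Tendsto (fun γ : ℝ => FrequencyHopping.rateUpperBound u v h i Rt γ /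
              (FrequencyHopping.multiplexingGain u v i * Real.logb 2 γ))
            atTop (𝓝 1))) := by
  have hC := FrequencyHopping.interferenceRateBound_nonneg v h i
  -- The remainder is constant in `γ`: at most `interferenceRateBound` nats for each of the `u`
  -- sub-bands, converted to bits.
  refine ⟨fun _ => u * FrequencyHopping.interferenceRateBound v h i / Real.log 2,
    ⟨_, tendsto_const_nhds⟩, fun P σ hP hσ => ?_, fun hi => ?_⟩
  · have hle := FrequencyHopping.achievableRate_le_ofReal_rateUpperBound v hv h i hcross P σ hP hσ
    exact ⟨(hle.trans_lt ENNReal.ofReal_lt_top).ne, ENNReal.toReal_le_of_le_ofReal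
      (FrequencyHopping.rateUpperBound_nonneg v (fun k => (hv k).2) h i (by positivity)
        (by positivity)) hle⟩
  · have hlim := FrequencyHopping.tendsto_rateUpperBound_div_logb (u := u) v (fun k => (hv k).1) h i
      hi (tendsto_const_nhds
        (x := u * FrequencyHopping.interferenceRateBound v h i / Real.log 2))
    refine ⟨hlim, fun hlt => ?_⟩
    have hg := FrequencyHopping.multiplexingGain_pos v i (hv i).1 hlt
    have h₁ := hlim.div_const (FrequencyHopping.multiplexingGain u v i)
    rw [div_self hg.ne'] at h₁
    refine h₁.congr fun γ => ?_
    rw [div_div, mul_comm (Real.logb 2 γ)]
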